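/- Call a subset of an abelian group $3$-AP-free if it contains no set of the form $\{x,x+d,x+2d\}$ with $d\neq 0$. For $n\ge 1$ let $r_3(n)$ be the maximum cardinality of a $3$-AP-free subset of $\{1,\dots,n\}$, and let $p_3(n)$ be the maximum of \[\mathbb{P}_{x\sim X,\,y\sim Y}\bigl(x+y\in Z\text{ and }x-y\in W\bigr)\] over all torsion-free abelian groups $G$ and all finite sets $X,Y,Z,W\subset G$ such that $|X|=|Y|=|Z|=n$ and $W$ is $3$-AP-free, where $x\in X$ and $y\in Y$ are chosen independently and uniformly at random. Then $p_3(n)\ll \left(\frac{r_3(n)}{n}\right)^{\Omega(1)}$; that is, there exist absolute constants $c>0$ and $C>0$ such that \[p_3(n)\le C\left(\frac{r_3(n)}{n}\right)^{c}\] for all sufficiently large $n$. -/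

import Mathlib

universe u

noncomputable section

/-- `r₃(n)`: the maximum cardinality of a 3-AP-free subset of `{1, …, n}`. -/
def r3 (n : ℕ) : ℕ := addRothNumber (Finset.Icc 1 n)

open Classical in
/-- The probability that `x + y ∈ Z` and `x - y ∈ W`, for `x ∈ X` and `y ∈ Y` chosen independently
and uniformly at random. -/
def sumDiffProb {G : Type u} [AddCommGroup G] (X Y Z W : Finset G) : ℝ :=
  (((X ×ˢ Y).filter fun q => q.1 + q.2 ∈ Z ∧ q.1 - q.2 ∈ W).card : ℝ) / ((X ×ˢ Y).card : ℝ)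

/-- The values of `sumDiffProb X Y Z W` over all finite subsets `X, Y, Z, W` of torsion-free abelian
groups such that `X, Y, Z` have cardinality `n` and `W` is 3-AP-free. -/
def sumDiffProbs (n : ℕ) : Set ℝ :=
  {p | ∃ (G : Type u) (_ : AddCommGroup G) (_ : IsAddTorsionFree G) (X Y Z W : Finset G),
    X.card = n ∧ Y.card = n ∧ Z.card = n ∧ ThreeAPFree (W : Set G) ∧ p = sumDiffProb X Y Z W}

/-- `p₃(n)`: the maximum of `sumDiffProbs n` (see `isGreatest_p3`). -/
def p3 (n : ℕ) : ℝ := sSup (sumDiffProbs.{u} n)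

/-- The supremum defining `p₃(n)` is a maximum. -/
theorem isGreatest_p3 (n : ℕ) : IsGreatest (sumDiffProbs.{u} n) (p3.{u} n) := by
  classical
  have hfin : (sumDiffProbs.{u} n).Finite := by
    refine ((Finset.range (n * n + 1)).image
      (fun k : ℕ => (k : ℝ) / ((n * n : ℕ) : ℝ))).finite_toSet.subset ?_
    rintro p ⟨G, _, _, X, Y, Z, W, hX, hY, -, -, rfl⟩
    have hc : (X ×ˢ Y).card = n * n := by rw [Finset.card_product, hX, hY]
    simp only [Finset.coe_image, Set.mem_image, Finset.mem_coe, Finset.mem_range]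
    refine ⟨_, ?_, by rw [sumDiffProb, hc]⟩
    exact Nat.lt_succ_of_le (hc ▸ Finset.card_filter_le _ _)
  have hne : (sumDiffProbs.{u} n).Nonempty := by
    obtain ⟨X, hX⟩ := Infinite.exists_subset_card_eq (ULift.{u} ℤ) n
    have : IsAddTorsionFree (ULift.{u} ℤ) :=
      Function.Injective.isAddTorsionFree (AddEquiv.ulift (α := ℤ)).toAddMonoidHom
        (AddEquiv.ulift (α := ℤ)).injective
    exact ⟨_, ULift.{u} ℤ, inferInstance, inferInstance, X, X, X, ∅, hX, hX, hX, by simp, rfl⟩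
  exact ⟨hne.csSup_mem hfin, fun _ h => le_csSup hfin.bddAbove h⟩

end

open Finset
open scoped Pointwise

/-! Let `δ` be the probability, and join `x` to `y` when `x + y ∈ Z` and `x - y ∈ W`. A
Balog–Szemerédi–Gowers argument that retains many edges gives `A ⊆ X`, `B ⊆ Y` spanning at least `δ
^ 2 / 32 * n ^ 2` edges, with `A + B` of size polynomial in `1 / δ` times `n`
(`exists_subsets_many_three_paths`). The differences along these edges form a set `W' ⊆ W` with at
least `δ ^ 2 / 32 * n` elements, and by Plünnecke–Ruzsa its second differences `a + c - 2b` lie in a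
set `D` of size `O_δ(n)`.

A Ruzsa-type model (`ThreeAPFree.card_le_four_mul_rothNumberNat`) puts a quarter of `W'` into `{0,
…, #D - 1}` without creating progressions. Subadditivity of the Roth number then bounds `#W'` by a
power of `1 / δ` times `r3 n`. -/

/-! ### Modelling 3-AP-free sets in an interval -/

theorem ZMod.card_filter_dvd_valMinAbs_le (q N : ℕ) [NeZero q] (hN : 0 < N) :
    #{t : ZMod q | t ≠ 0 ∧ (N : ℤ) ∣ t.valMinAbs} ≤ 2 * (q / 2 / N) := by
  set m := q / 2 / N with hm
  have hcard : #((Icc (-(m : ℤ)) m).erase 0) = 2 * m := by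
    rw [card_erase_of_mem (by simp), Int.card_Icc]
    omega
  rw [← hcard]
  refine card_le_card_of_injOn (fun t => t.valMinAbs / N) ?_ ?_
  · intro t ht
    simp only [coe_filter, mem_univ, true_and, Set.mem_ofPred_eq] at ht
    obtain ⟨h0, k, hk⟩ := ht
    have hN' : (N : ℤ) ≠ 0 := by exact_mod_cast hN.ne'
    have hle := ZMod.natAbs_valMinAbs_le t
    have h1 : t.valMinAbs / N = k := by rw [hk, Int.mul_ediv_cancel_left _ hN']
    have hk0 : k ≠ 0 := by
      rintro rfl
      exact h0 ((ZMod.valMinAbs_eq_zero t).1 (by simpa using hk))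
    have hkm : k.natAbs ≤ m := by
      rw [hm, Nat.le_div_iff_mul_le hN]
      rw [hk, Int.natAbs_mul, Int.natAbs_natCast] at hle
      linarith
    simp only [coe_erase, coe_Icc, Set.mem_sdiff, Set.mem_Icc, Set.mem_singleton_iff, h1]
    exact ⟨by omega, hk0⟩
  · intro s hs t ht hst
    simp only [coe_filter, mem_univ, true_and, Set.mem_ofPred_eq] at hs ht
    apply ZMod.injective_valMinAbs
    rw [← Int.ediv_mul_cancel hs.2, ← Int.ediv_mul_cancel ht.2]
    simp only at hst
    rw [hst]

/-- Fewer than `N` nonzero integers can be dilated modulo a prime so that none of them becomes a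
multiple of `N`. -/
theorem exists_prime_dilate_not_dvd (F : Finset ℤ) (h0 : 0 ∉ F) (N : ℕ) (hF : #F < N) :
    ∃ (q : ℕ) (_ : Fact q.Prime) (c : ZMod q),
      ∀ d ∈ F, ¬ (N : ℤ) ∣ (c * (d : ZMod q)).valMinAbs := by
  classical
  have hN : 0 < N := by omega
  obtain ⟨q, hq, hqp⟩ := Nat.exists_infinite_primes (∑ d ∈ F, d.natAbs + 3)
  have : Fact q.Prime := ⟨hqp⟩
  refine ⟨q, ⟨hqp⟩, ?_⟩
  have hne : ∀ d ∈ F, (d : ZMod q) ≠ 0 := by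
    intro d hd h
    rw [ZMod.intCast_zmod_eq_zero_iff_dvd] at h
    have h1 := Int.natAbs_dvd_natAbs.2 h
    have h2 : d.natAbs ≤ ∑ d ∈ F, d.natAbs :=
      single_le_sum (f := Int.natAbs) (fun _ _ => Nat.zero_le _) hd
    have h3 : d ≠ 0 := fun h => h0 (h ▸ hd)
    have := Nat.le_of_dvd (Int.natAbs_pos.2 h3) h1
    simp at this
    omega
  -- Union bound: each `d` excludes at most `2 * (q / 2 / N)` of the `q - 1` nonzero dilates, and
  -- there are fewer than `N` such `d`.
  by_contra! hcon
  have hsub : (univ.erase (0 : ZMod q)) ⊆ F.biUnion fun d =>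
      (univ.erase (0 : ZMod q)).filter fun c => (N : ℤ) ∣ (c * (d : ZMod q)).valMinAbs := by
    intro c hc
    obtain ⟨d, hd, hdv⟩ := hcon c
    exact mem_biUnion.2 ⟨d, hd, mem_filter.2 ⟨hc, hdv⟩⟩
  have h1 := (card_le_card hsub).trans (card_biUnion_le_card_mul _ _ (2 * (q / 2 / N)) fun d hd => by
    refine le_trans ?_ (ZMod.card_filter_dvd_valMinAbs_le q N hN)
    refine card_le_card_of_injOn (fun c => c * (d : ZMod q)) ?_ ?_
    · intro c hc
      simp only [coe_filter, mem_erase, mem_univ, and_true, Set.mem_ofPred_eq, true_and] at hc ⊢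
      exact ⟨mul_ne_zero hc.1 (hne d hd), hc.2⟩
    · intro a _ b _ hab
      exact mul_right_cancel₀ (hne d hd) hab)
  rw [card_erase_of_mem (mem_univ _), card_univ, ZMod.card] at h1
  set m := q / 2 / N
  have hm : m * N ≤ q / 2 := Nat.div_mul_le_self _ _
  have hodd : q % 2 = 1 := (hqp.eq_two_or_odd).resolve_left (by omega)
  rcases Nat.eq_zero_or_pos m with h | h
  · rw [h] at h1; omega
  · have : #F * m < N * m := Nat.mul_lt_mul_of_pos_right hF h
    have e : #F * (2 * m) = 2 * (#F * m) := by ring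
    have e' : m * N = N * m := by ring
    omega

/-- Coordinates become coefficients of polynomials; evaluation at an integer that is not a root of
their product is the required map. -/
theorem exists_addMonoidHom_int_ne_zero {G : Type*} [AddCommGroup G] [IsAddTorsionFree G]
    [Module.Finite ℤ G] (F : Finset G) (h0 : 0 ∉ F) : ∃ f : G →+ ℤ, ∀ d ∈ F, f d ≠ 0 := by
  classical
  let e := (Module.finBasis ℤ G).equivFun.trans
    (Polynomial.degreeLTEquiv ℤ (Module.finrank ℤ G)).symm
  have hprod : ∏ d ∈ F, (e d : Polynomial ℤ) ≠ 0 := by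
    refine prod_ne_zero_iff.2 fun d hd h => h0 ?_
    have h1 : e d = 0 := Subtype.ext h
    exact (e.map_eq_zero_iff.1 h1) ▸ hd
  obtain ⟨B, hB⟩ : ∃ B : ℤ, (∏ d ∈ F, (e d : Polynomial ℤ)).eval B ≠ 0 := by
    by_contra! h
    exact hprod (Polynomial.funext fun B => by rw [h B, Polynomial.eval_zero])
  rw [Polynomial.eval_prod, prod_ne_zero_iff] at hB
  exact ⟨((Polynomial.leval B).comp ((Submodule.subtype _).comp e.toLinearMap)).toAddMonoidHom, hB⟩

theorem ThreeAPFree.card_le_four_mul_rothNumberNat_of_finite {G : Type*} [AddCommGroup G]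
    [IsAddTorsionFree G] [Module.Finite ℤ G] {W D : Finset G} (hW : ThreeAPFree (W : Set G))
    (hD : ∀ a ∈ W, ∀ b ∈ W, ∀ c ∈ W, a + c - (b + b) ∈ D) : #W ≤ 4 * rothNumberNat #D := by
  classical
  obtain rfl | ⟨w, hw⟩ := W.eq_empty_or_nonempty
  · simp
  have h0D : (0 : G) ∈ D := by simpa using hD w hw w hw w hw
  obtain ⟨f, hf⟩ := exists_addMonoidHom_int_ne_zero (D.erase 0) (by simp)
  set N := #D
  have hN : 0 < N := card_pos.2 ⟨0, h0D⟩
  obtain ⟨q, hq, c, hc⟩ := exists_prime_dilate_not_dvd ((D.erase 0).image f)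
    (fun h => by
      obtain ⟨d, hd, hfd⟩ := mem_image.1 h
      exact hf d hd hfd) N
    (card_image_le.trans_lt (card_erase_lt_of_mem h0D))
  have hq0 : 0 < q := hq.out.pos
  set l : G → ℕ := fun g => (c * ((f g : ℤ) : ZMod q)).val with hl
  have hlq : ∀ g, l g < q := fun g => ZMod.val_lt _
  -- Within one quarter of `[0, q)`, `l a + l e - 2 * l b` lies strictly between `-q / 2` and `q /
  -- 2`, so it is the centred residue of the dilated second difference. If `N` divides it, the
  -- choice of `c` forces `a + e = b + b`.
  have hmaps : ∀ g ∈ W, 4 * l g / q ∈ range 4 := by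
    intro g _
    rw [mem_range, Nat.div_lt_iff_lt_mul hq0]
    have := hlq g
    omega
  rw [card_eq_sum_card_fiberwise hmaps]
  refine (sum_le_card_nsmul _ _ (rothNumberNat N) fun j _ => ?_).trans (by simp)
  have key : ∀ a ∈ W.filter (fun g => 4 * l g / q = j), ∀ b ∈ W.filter (fun g => 4 * l g / q = j),
      ∀ e ∈ W.filter (fun g => 4 * l g / q = j),
      l a % N + l e % N = l b % N + l b % N → a + e = b + b := by
    intro a ha b hb e he h
    rw [mem_filter] at ha hb he
    by_contra hne
    have hd0 : a + e - (b + b) ≠ 0 := sub_ne_zero.2 hne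
    refine hc _ (mem_image_of_mem f (mem_erase.2 ⟨hd0, hD a ha.1 b hb.1 e he.1⟩)) ?_
    have hbd : ∀ g, 4 * l g / q = j → j * q ≤ 4 * l g ∧ 4 * l g < j * q + q := by
      rintro g rfl
      refine ⟨Nat.div_mul_le_self _ _, ?_⟩
      have := Nat.lt_div_mul_add hq0 (a := 4 * l g)
      omega
    have h1 := hbd a ha.2
    have h2 := hbd b hb.2
    have h3 := hbd e he.2
    have hval : (c * ((f (a + e - (b + b)) : ℤ) : ZMod q)).valMinAbs
        = (l a : ℤ) + l e - (l b + l b) := by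
      rw [ZMod.valMinAbs_spec]
      refine ⟨?_, ?_, ?_⟩
      · simp only [hl, map_sub, map_add]
        push_cast
        simp only [ZMod.natCast_val, ZMod.cast_id', id]
        ring
      · omega
      · omega
    rw [hval]
    have hmod : (l a + l e) ≡ (l b + l b) [MOD N] := by
      rw [Nat.ModEq, Nat.add_mod, h, ← Nat.add_mod]
    have := (Nat.modEq_iff_dvd.1 hmod.symm)
    push_cast at this
    exact this
  have hinj : Set.InjOn (fun g => l g % N) (W.filter (fun g => 4 * l g / q = j) : Set G) := by
    intro a ha b hb hab
    simp only at hab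
    -- The degenerate progression `a, b, a` gives `2a = 2b`.
    have := key a ha b hb a ha (by rw [hab])
    rw [← two_nsmul, ← two_nsmul] at this
    exact nsmul_right_injective two_ne_zero this
  rw [← card_image_of_injOn hinj]
  refine ThreeAPFree.le_rothNumberNat _ ?_ ?_ rfl
  · rw [coe_image]
    rintro _ ⟨a, ha, rfl⟩ _ ⟨b, hb, rfl⟩ _ ⟨e, he, rfl⟩ h
    have h1 := key a ha b hb e he h
    rw [hW (mem_filter.1 ha).1 (mem_filter.1 hb).1 (mem_filter.1 he).1 h1]
  · intro x hx
    obtain ⟨g, _, rfl⟩ := mem_image.1 hx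
    exact Nat.mod_lt _ hN

/-- A 3-AP-free set `W` in a torsion-free group whose set of differences `a + c - 2b` has size at
most `N` is, up to a factor `4`, no larger than a 3-AP-free subset of `{0, …, N - 1}`. -/
theorem ThreeAPFree.card_le_four_mul_rothNumberNat {G : Type*} [AddCommGroup G]
    [IsAddTorsionFree G] {W D : Finset G} (hW : ThreeAPFree (W : Set G))
    (hD : ∀ a ∈ W, ∀ b ∈ W, ∀ c ∈ W, a + c - (b + b) ∈ D) : #W ≤ 4 * rothNumberNat #D := by
  classical
  -- The group generated by `W` is finitely generated, hence free.
  set H := AddSubgroup.closure (W : Set G)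
  have : AddGroup.FG H := (AddGroup.fg_iff_addSubgroup_fg H).2 ⟨W, rfl⟩
  have : Module.Finite ℤ H := Module.Finite.iff_addGroup_fg.2 inferInstance
  have : IsAddTorsionFree H :=
    Function.Injective.isAddTorsionFree H.subtype H.subtype_injective
  have hinj : Function.Injective (H.subtype : H → G) := H.subtype_injective
  have hsub : W ⊆ (W.preimage H.subtype hinj.injOn).image H.subtype := by
    intro w hw
    exact mem_image.2 ⟨⟨w, AddSubgroup.subset_closure hw⟩, by simpa using hw, rfl⟩
  have hDcard : #(D.preimage H.subtype hinj.injOn) ≤ #D :=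
    card_le_card_of_injOn H.subtype (fun x hx => by simpa using hx) hinj.injOn
  calc #W ≤ #(W.preimage H.subtype hinj.injOn) := (card_le_card hsub).trans card_image_le
    _ ≤ 4 * rothNumberNat #(D.preimage H.subtype hinj.injOn) := by
        refine ThreeAPFree.card_le_four_mul_rothNumberNat_of_finite ?_ ?_
        · intro a ha b hb e he h
          rw [mem_coe, mem_preimage] at ha hb he
          exact hinj (hW ha hb he (by simpa using congrArg H.subtype h))
        · intro a ha b hb e he
          rw [mem_preimage] at *
          simpa using hD _ ha _ hb _ he
    _ ≤ 4 * rothNumberNat #D := Nat.mul_le_mul_left _ (rothNumberNat.mono hDcard)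

/-! ### Roth numbers -/

theorem rothNumberNat_mul_le (k n : ℕ) : rothNumberNat (k * n) ≤ k * rothNumberNat n := by
  induction k with
  | zero => simp
  | succ k ih =>
    rw [Nat.succ_mul, Nat.succ_mul]
    exact (rothNumberNat_add_le _ _).trans (Nat.add_le_add_right ih _)

theorem r3_eq_rothNumberNat (n : ℕ) : r3 n = rothNumberNat n := by
  have : Icc 1 n = Ico 1 (n + 1) := by ext; simp
  rw [r3, this, addRothNumber_Ico, Nat.add_sub_cancel]

/-! ### Dependent random choice and paths of length three -/

theorem Finset.sum_sub_mul_card_le_sum_filter {ι : Type*} (S : Finset ι) (f : ι → ℝ) (t : ℝ)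
    (ht : 0 ≤ t) : ∑ i ∈ S, f i - t * #S ≤ ∑ i ∈ S with t ≤ f i, f i := by
  have h1 := sum_filter_add_sum_filter_not S (fun i => t ≤ f i) f
  have h2 : ∑ i ∈ S with ¬ t ≤ f i, f i ≤ t * #S := by
    calc ∑ i ∈ S with ¬ t ≤ f i, f i ≤ ∑ i ∈ S with ¬ t ≤ f i, t :=
          sum_le_sum fun i hi => (not_le.1 (mem_filter.1 hi).2).le
      _ = t * #{i ∈ S | ¬ t ≤ f i} := by rw [sum_const, nsmul_eq_mul, mul_comm]
      _ ≤ t * #S := by gcongr; exact filter_subset _ _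
  linarith

theorem Finset.card_filter_product_eq_sum_left {α β : Type*} (X : Finset α) (Y : Finset β)
    (r : α → β → Prop) [∀ a b, Decidable (r a b)] :
    #{p ∈ X ×ˢ Y | r p.1 p.2} = ∑ x ∈ X, #{y ∈ Y | r x y} := by
  simp only [card_filter, sum_product]

theorem Finset.card_filter_product_eq_sum_right {α β : Type*} (X : Finset α) (Y : Finset β)
    (r : α → β → Prop) [∀ a b, Decidable (r a b)] :
    #{p ∈ X ×ˢ Y | r p.1 p.2} = ∑ y ∈ Y, #{x ∈ X | r x y} := by
  simp only [card_filter, sum_product_right]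

open Classical in
/-- Dependent random choice: a dense bipartite graph has a large neighbourhood in which few pairs
have a small common neighbourhood. -/
theorem exists_neighborhood_few_bad_pairs {α β : Type*} (X : Finset α) (Y : Finset β)
    (hY : Y.Nonempty) (r : α → β → Prop) {m σ ε : ℝ} (hm : #X ≤ m) (hσ : 0 ≤ σ) (hε : 0 ≤ ε)
    (h : σ * m * #Y ≤ #{p ∈ X ×ˢ Y | r p.1 p.2}) :
    ∃ N ⊆ X, ε * σ ^ 2 / 2 * m ^ 2 +
      (#{p ∈ N ×ˢ N | (#{y ∈ Y | r p.1 y ∧ r p.2 y} : ℝ) < ε * σ ^ 2 / 2 * #Y} : ℝ)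
        ≤ ε * (#N : ℝ) ^ 2 := by
  have hm0 : 0 ≤ m := (Nat.cast_nonneg _).trans hm
  have hY0 : (0 : ℝ) < #Y := by exact_mod_cast hY.card_pos
  set τ := ε * σ ^ 2 / 2 with hτ
  have hτ0 : 0 ≤ τ := by positivity
  set P := {p ∈ X ×ˢ X | (#{y ∈ Y | r p.1 y ∧ r p.2 y} : ℝ) < τ * #Y} with hP
  have hsq : σ ^ 2 * m ^ 2 * #Y ≤ ∑ y ∈ Y, (#{x ∈ X | r x y} : ℝ) ^ 2 := by
    have h1 := sq_sum_le_card_mul_sum_sq (s := Y) (f := fun y => (#{x ∈ X | r x y} : ℝ))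
    rw [card_filter_product_eq_sum_right X Y r] at h
    push_cast at h
    have h2 := pow_le_pow_left₀ (by positivity) h 2
    have h3 : (σ ^ 2 * m ^ 2 * #Y) * #Y ≤ (∑ y ∈ Y, (#{x ∈ X | r x y} : ℝ) ^ 2) * #Y := by
      linarith
    exact le_of_mul_le_mul_right h3 hY0
  have hbad : ∑ y ∈ Y, (#{p ∈ P | r p.1 y ∧ r p.2 y} : ℝ) ≤ τ * m ^ 2 * #Y := by
    have h1 : ∑ y ∈ Y, #{p ∈ P | r p.1 y ∧ r p.2 y} = ∑ p ∈ P, #{y ∈ Y | r p.1 y ∧ r p.2 y} := by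
      rw [← card_filter_product_eq_sum_left, ← card_filter_product_eq_sum_right]
    calc ∑ y ∈ Y, (#{p ∈ P | r p.1 y ∧ r p.2 y} : ℝ)
        = ∑ p ∈ P, (#{y ∈ Y | r p.1 y ∧ r p.2 y} : ℝ) := by exact_mod_cast h1
      _ ≤ ∑ p ∈ P, τ * #Y := sum_le_sum fun p hp => (mem_filter.1 hp).2.le
      _ = #P * (τ * #Y) := by rw [sum_const, nsmul_eq_mul]
      _ ≤ m ^ 2 * (τ * #Y) := by
          gcongr
          have : #P ≤ #X * #X := (card_filter_le _ _).trans (card_product _ _).le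
          have : (#P : ℝ) ≤ #X * #X := by exact_mod_cast this
          nlinarith [(Nat.cast_nonneg #X : (0 : ℝ) ≤ #X)]
      _ = τ * m ^ 2 * #Y := by ring
  -- Average over `y`, with `N` its neighbourhood: `hsq` is Cauchy–Schwarz, and the factor `1 / 2`
  -- in `τ` makes the bad pairs cost only half of the main term.
  obtain ⟨y, hy, hle⟩ : ∃ y ∈ Y, τ * m ^ 2 ≤
      ε * (#{x ∈ X | r x y} : ℝ) ^ 2 - #{p ∈ P | r p.1 y ∧ r p.2 y} := by
    apply exists_le_of_sum_le hY
    rw [sum_const, nsmul_eq_mul, sum_sub_distrib, ← mul_sum]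
    have := mul_le_mul_of_nonneg_left hsq hε
    have e : ε * (σ ^ 2 * m ^ 2 * #Y) = 2 * (τ * m ^ 2 * #Y) := by rw [hτ]; ring
    linarith
  refine ⟨{x ∈ X | r x y}, filter_subset _ _, ?_⟩
  have e : {p ∈ {x ∈ X | r x y} ×ˢ {x ∈ X | r x y} |
      (#{y ∈ Y | r p.1 y ∧ r p.2 y} : ℝ) < τ * #Y} = {p ∈ P | r p.1 y ∧ r p.2 y} := by
    ext p
    simp only [hP, mem_filter, mem_product]
    tauto
  rw [e]
  linarith

open Classical in
/-- The combinatorial core of the Balog–Szemerédi–Gowers theorem, in a form that retains many edges: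
a dense bipartite graph contains large vertex sets which span many edges and any two vertices of
which are joined by many paths of length three. -/
theorem exists_subsets_many_three_paths {α β : Type*} (X : Finset α) (Y : Finset β)
    (r : α → β → Prop) {δ : ℝ} (hδ : 0 < δ) (hX : X.Nonempty) (hY : Y.Nonempty)
    (h : δ * #X * #Y ≤ #{p ∈ X ×ˢ Y | r p.1 p.2}) :
    ∃ A ⊆ X, ∃ B ⊆ Y, δ ^ 2 / 32 * #X * #Y ≤ #{p ∈ A ×ˢ B | r p.1 p.2} ∧
      ∀ a ∈ A, ∀ b ∈ B, δ ^ 5 / 2 ^ 14 * #X * #Y ≤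
        #{p ∈ X ×ˢ Y | r p.1 b ∧ r a p.2 ∧ r p.1 p.2} := by
  have hX0 : (0 : ℝ) < #X := by exact_mod_cast hX.card_pos
  have hY0 : (0 : ℝ) < #Y := by exact_mod_cast hY.card_pos
  set deg : α → ℝ := fun x => #{y ∈ Y | r x y} with hdeg
  set X₀ := {x ∈ X | δ / 2 * #Y ≤ deg x} with hX₀
  have hE₀ : δ / 2 * #X * #Y ≤ #{p ∈ X₀ ×ˢ Y | r p.1 p.2} := by
    have h1 := sum_sub_mul_card_le_sum_filter X deg (δ / 2 * #Y) (by positivity)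
    rw [card_filter_product_eq_sum_left X Y r] at h
    rw [card_filter_product_eq_sum_left X₀ Y r]
    push_cast at h ⊢
    linarith
  -- Density is measured against `#X`, so no lower bound on `#X₀` is needed.
  obtain ⟨N, hN, hNbad⟩ := exists_neighborhood_few_bad_pairs X₀ Y hY r (m := #X) (σ := δ / 2)
    (ε := δ / 32) (by exact_mod_cast card_filter_le _ _) (by positivity) (by positivity) hE₀
  set τ := δ / 32 * (δ / 2) ^ 2 / 2 with hτ
  have hτ0 : 0 < τ := by positivity
  set bad : α → α → Prop := fun a a' => (#{y ∈ Y | r a y ∧ r a' y} : ℝ) < τ * #Y with hbaddef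
  have hbad : (#{p ∈ N ×ˢ N | bad p.1 p.2} : ℝ) ≤ δ / 32 * (#N : ℝ) ^ 2 := by
    have : 0 ≤ τ * (#X : ℝ) ^ 2 := by positivity
    linarith
  have hNcard : δ / 4 * #X ≤ #N := by
    have h1 : τ * (#X : ℝ) ^ 2 ≤ δ / 32 * (#N : ℝ) ^ 2 := by
      have : (0 : ℝ) ≤ #{p ∈ N ×ˢ N | bad p.1 p.2} := Nat.cast_nonneg _
      linarith
    have h2 : (δ / 4 * #X) ^ 2 ≤ (#N : ℝ) ^ 2 := by
      have h3 : δ / 32 * ((δ / 2) ^ 2 / 2 * (#X : ℝ) ^ 2) ≤ δ / 32 * (#N : ℝ) ^ 2 := by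
        rw [hτ] at h1; linarith
      have h4 := le_of_mul_le_mul_left h3 (by positivity)
      nlinarith [sq_nonneg (δ * #X)]
    exact le_of_sq_le_sq h2 (Nat.cast_nonneg _)
  have hN0 : (0 : ℝ) < #N := lt_of_lt_of_le (by positivity) hNcard
  set A := {a ∈ N | (#{a' ∈ N | bad a a'} : ℝ) ≤ δ / 16 * #N} with hA
  have hAcard : (#N : ℝ) / 2 ≤ #A := by
    have h1 : (#{a ∈ N | ¬ (#{a' ∈ N | bad a a'} : ℝ) ≤ δ / 16 * #N} : ℝ) * (δ / 16 * #N)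
        ≤ #{p ∈ N ×ˢ N | bad p.1 p.2} := by
      rw [card_filter_product_eq_sum_left N N bad, ← nsmul_eq_mul, ← sum_const]
      push_cast
      refine (sum_le_sum fun a ha => (not_le.1 (mem_filter.1 ha).2).le).trans ?_
      exact sum_le_sum_of_subset_of_nonneg (filter_subset _ _) fun _ _ _ => Nat.cast_nonneg _
    have h2 : (#A : ℝ) + #{a ∈ N | ¬ (#{a' ∈ N | bad a a'} : ℝ) ≤ δ / 16 * #N} = #N := by
      exact_mod_cast card_filter_add_card_filter_not _
    have h3 : (#{a ∈ N | ¬ (#{a' ∈ N | bad a a'} : ℝ) ≤ δ / 16 * #N} : ℝ) * (δ / 16 * #N)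
        ≤ (#N : ℝ) / 2 * (δ / 16 * #N) := by
      refine (h1.trans hbad).trans (le_of_eq ?_)
      ring
    have h4 := le_of_mul_le_mul_right h3 (by positivity)
    linarith
  have hAX : A ⊆ X₀ := (filter_subset _ _).trans hN
  set B := {b ∈ Y | δ / 4 * #A ≤ (#{a ∈ A | r a b} : ℝ)} with hB
  refine ⟨A, hAX.trans (filter_subset _ _), B, filter_subset _ _, ?_, ?_⟩
  · have h1 := sum_sub_mul_card_le_sum_filter Y (fun b => (#{a ∈ A | r a b} : ℝ)) (δ / 4 * #A)
      (by positivity)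
    have h2 : δ / 2 * #Y * #A ≤ ∑ b ∈ Y, (#{a ∈ A | r a b} : ℝ) := by
      have e := (card_filter_product_eq_sum_right A Y r).symm.trans
        (card_filter_product_eq_sum_left A Y r)
      have e' : ∑ b ∈ Y, (#{a ∈ A | r a b} : ℝ) = ∑ a ∈ A, (#{y ∈ Y | r a y} : ℝ) := by
        exact_mod_cast e
      rw [e', mul_comm, ← nsmul_eq_mul, ← sum_const]
      exact sum_le_sum fun a ha => (mem_filter.1 (hAX ha)).2
    rw [card_filter_product_eq_sum_right A B r]
    push_cast
    have h3 : δ / 8 * #X ≤ #A := by linarith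
    have h4 := mul_le_mul_of_nonneg_left h3 (show 0 ≤ δ / 4 * #Y by positivity)
    linarith
  · intro a ha b hb
    -- The path is `a, y, a', b`: `b` has at least `δ / 8 * #N` neighbours in `A`, at most `δ / 16 *
    -- #N` of them bad for `a`, and each other one shares at least `τ * #Y` neighbours with `a`.
    set S := {a' ∈ A | r a' b ∧ ¬ bad a a'} with hS
    have hScard : δ ^ 2 / 64 * #X ≤ #S := by
      have h1 : #{a' ∈ A | r a' b} ≤ #S + #{a' ∈ N | bad a a'} := by
        refine le_trans (card_le_card ?_) (card_union_le _ _)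
        intro x hx
        rw [mem_filter] at hx
        by_cases hbx : bad a x
        · exact mem_union_right _ (mem_filter.2 ⟨(mem_filter.1 hx.1).1, hbx⟩)
        · exact mem_union_left _ (mem_filter.2 ⟨hx.1, hx.2, hbx⟩)
      have h1' : (#{a' ∈ A | r a' b} : ℝ) ≤ #S + #{a' ∈ N | bad a a'} := by exact_mod_cast h1
      have h2 := (mem_filter.1 hb).2
      have h3 := (mem_filter.1 ha).2
      have h4 := mul_le_mul_of_nonneg_left hAcard (show 0 ≤ δ / 4 by positivity)
      have h5 := mul_le_mul_of_nonneg_left hNcard (show 0 ≤ δ / 16 by positivity)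
      linarith
    have hle : #S * (τ * #Y) ≤ #{p ∈ X ×ˢ Y | r p.1 b ∧ r a p.2 ∧ r p.1 p.2} := by
      rw [card_filter_product_eq_sum_left X Y (fun x y => r x b ∧ r a y ∧ r x y),
        ← nsmul_eq_mul, ← sum_const]
      push_cast
      refine le_trans (sum_le_sum fun x hx => ?_) (sum_le_sum_of_subset_of_nonneg
        (((filter_subset _ A).trans hAX).trans (filter_subset _ _)) fun _ _ _ => Nat.cast_nonneg _)
      obtain ⟨-, hxb, hx⟩ := mem_filter.1 hx
      simpa only [hxb, true_and] using not_lt.1 hx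
    refine le_trans ?_ hle
    calc δ ^ 5 / 2 ^ 14 * #X * #Y = δ ^ 2 / 64 * #X * (τ * #Y) := by rw [hτ]; ring
      _ ≤ #S * (τ * #Y) := by gcongr

/-! ### Sumset estimates -/

open Classical in
-- Each path writes `a + b = (a + y) - (x + y) + (x + b)` with all three terms in `Z`, and the
-- triple determines the path.
theorem Finset.card_add_mul_le_of_three_paths {G : Type*} [AddCommGroup G] (A B X Y Z : Finset G)
    (t : ℕ) (h : ∀ a ∈ A, ∀ b ∈ B,
      t ≤ #{p ∈ X ×ˢ Y | p.1 + b ∈ Z ∧ a + p.2 ∈ Z ∧ p.1 + p.2 ∈ Z}) :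
    #(A + B) * t ≤ #Z ^ 3 := by
  have h1 : ∑ s ∈ A + B, #{z ∈ Z ×ˢ Z ×ˢ Z | z.1 - z.2.1 + z.2.2 = s} ≤ #(Z ×ˢ Z ×ˢ Z) := by
    rw [sum_card_fiberwise_eq_card_filter (Z ×ˢ Z ×ˢ Z) (A + B)
      (fun z : G × G × G => z.1 - z.2.1 + z.2.2)]
    exact card_filter_le _ _
  calc #(A + B) * t = ∑ s ∈ A + B, t := by rw [sum_const, smul_eq_mul]
    _ ≤ ∑ s ∈ A + B, #{z ∈ Z ×ˢ Z ×ˢ Z | z.1 - z.2.1 + z.2.2 = s} := by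
        refine sum_le_sum fun s hs => ?_
        obtain ⟨a, ha, b, hb, rfl⟩ := mem_add.1 hs
        refine (h a ha b hb).trans (card_le_card_of_injOn
          (fun p => (a + p.2, p.1 + p.2, p.1 + b)) ?_ ?_)
        · intro p hp
          simp only [coe_filter, Set.mem_ofPred_eq, mem_product] at hp ⊢
          exact ⟨⟨hp.2.2.1, hp.2.2.2, hp.2.1⟩, by abel⟩
        · intro p _ p' _ he
          simp only [Prod.mk.injEq, add_right_inj, add_left_inj] at he
          exact Prod.ext he.2.2 he.1
    _ ≤ #(Z ×ˢ Z ×ˢ Z) := h1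
    _ = #Z ^ 3 := by rw [card_product, card_product]; ring

open Classical in
-- Plünnecke through `B` bounds `A + A`, hence `A + (A ∪ B)`; Plünnecke through `A` then bounds the
-- eightfold combination.
theorem Finset.card_nsmul_union_sub_nsmul_union_le {G : Type*} [AddCommGroup G] {A B : Finset G}
    (hA : A.Nonempty) (hB : B.Nonempty) {R : ℝ} (hRA : #(A + B) ≤ R * #A)
    (hRB : #(A + B) ≤ R * #B) :
    1 ≤ R ∧ (#(4 • (A ∪ B) - 4 • (A ∪ B)) : ℝ) ≤ 256 * R ^ 24 * #A := by
  have hA0 : (0 : ℝ) < #A := by exact_mod_cast hA.card_pos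
  have hB0 : (0 : ℝ) < #B := by exact_mod_cast hB.card_pos
  have hAle : (#A : ℝ) ≤ #(A + B) := by exact_mod_cast card_le_card_add_right hB
  have hBle : (#B : ℝ) ≤ #(A + B) := by exact_mod_cast card_le_card_add_left hA
  have hR1 : 1 ≤ R := by
    by_contra! h
    nlinarith
  have hAA : (#(A + A) : ℝ) ≤ R ^ 3 * #A := by
    have h1 := pluennecke_ruzsa_inequality_nsmul_add hB A 2
    have h2 := (NNRat.cast_le (K := ℝ)).2 h1
    push_cast at h2
    rw [two_nsmul, add_comm B A] at h2
    have h3 : (#(A + B) : ℝ) / #B ≤ R := (div_le_iff₀ hB0).2 hRB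
    calc (#(A + A) : ℝ) ≤ (#(A + B) / #B : ℝ) ^ 2 * #B := h2
      _ ≤ R ^ 2 * (R * #A) := by gcongr; linarith
      _ = R ^ 3 * #A := by ring
  have hAT : (#(A + (A ∪ B)) : ℝ) ≤ 2 * R ^ 3 * #A := by
    have h1 : (#(A + (A ∪ B)) : ℝ) ≤ #(A + A) + #(A + B) := by
      rw [add_union]
      exact_mod_cast card_union_le _ _
    have h2 : R * #A ≤ R ^ 3 * #A := by
      gcongr
      exact le_self_pow₀ hR1 (by norm_num)
    linarith
  refine ⟨hR1, ?_⟩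
  have h1 := pluennecke_ruzsa_inequality_nsmul_sub_nsmul_add hA (A ∪ B) 4 4
  have h2 := (NNRat.cast_le (K := ℝ)).2 h1
  push_cast at h2
  calc (#(4 • (A ∪ B) - 4 • (A ∪ B)) : ℝ) ≤ (#(A + (A ∪ B)) / #A : ℝ) ^ (4 + 4) * #A := h2
    _ ≤ (2 * R ^ 3) ^ (4 + 4) * #A := by
        gcongr
        exact (div_le_iff₀ hA0).2 hAT
    _ = 256 * R ^ 24 * #A := by ring

/-! ### Assembling the bound -/

open Classical in
theorem pow_mul_le_mul_rothNumberNat {G : Type*} [AddCommGroup G] [IsAddTorsionFree G]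
    {X Y Z W : Finset G} {n : ℕ} (hn : 0 < n) (hX : #X = n) (hY : #Y = n) (hZ : #Z = n)
    (hW : ThreeAPFree (W : Set G)) {δ : ℝ} (hδ : 0 < δ)
    (h : δ * n * n ≤ #{p ∈ X ×ˢ Y | p.1 + p.2 ∈ Z ∧ p.1 - p.2 ∈ W}) :
    δ ^ 170 * n ≤ 2 ^ 472 * rothNumberNat n := by
  have hn0 : (0 : ℝ) < n := by exact_mod_cast hn
  obtain ⟨A, hAX, B, hBY, hE, hpath⟩ := exists_subsets_many_three_paths X Y
    (fun x y => x + y ∈ Z ∧ x - y ∈ W) hδ (card_pos.1 (hX ▸ hn)) (card_pos.1 (hY ▸ hn))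
    (by rw [hX, hY]; convert h)
  rw [hX, hY] at hE
  rw [hX, hY] at hpath
  set E := {p ∈ A ×ˢ B | p.1 + p.2 ∈ Z ∧ p.1 - p.2 ∈ W} with hEdef
  have hE' : δ ^ 2 / 32 * n * n ≤ #E := by convert hE
  have hAn : #A ≤ n := hX ▸ card_le_card hAX
  have hBn : #B ≤ n := hY ▸ card_le_card hBY
  have hEAB : (#E : ℝ) ≤ #A * #B := by
    exact_mod_cast (card_filter_le _ _).trans (card_product A B).le
  have hAl : δ ^ 2 / 32 * n ≤ #A := by
    refine le_of_mul_le_mul_right (hE'.trans (hEAB.trans ?_)) hn0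
    gcongr
  have hBl : δ ^ 2 / 32 * n ≤ #B := by
    refine le_of_mul_le_mul_right (hE'.trans (hEAB.trans ?_)) hn0
    rw [mul_comm]
    gcongr
  have hA : A.Nonempty := card_pos.1 (by
    have : (0 : ℝ) < #A := lt_of_lt_of_le (by positivity) hAl
    exact_mod_cast this)
  have hB : B.Nonempty := card_pos.1 (by
    have : (0 : ℝ) < #B := lt_of_lt_of_le (by positivity) hBl
    exact_mod_cast this)
  have hsum : (#(A + B) : ℝ) * (δ ^ 5 / 2 ^ 14) ≤ n := by
    have h1 := card_add_mul_le_of_three_paths A B X Y Z ⌈δ ^ 5 / 2 ^ 14 * n * n⌉₊ (by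
      intro a ha b hb
      refine Nat.ceil_le.2 ((hpath a ha b hb).trans ?_)
      refine Nat.cast_le.2 (card_le_card fun p hp => ?_)
      simp only [mem_filter] at hp ⊢
      exact ⟨hp.1, hp.2.1.1, hp.2.2.1.1, hp.2.2.2.1⟩)
    rw [hZ] at h1
    have h2 : (#(A + B) : ℝ) * ⌈δ ^ 5 / 2 ^ 14 * n * n⌉₊ ≤ (n : ℝ) ^ 3 := by exact_mod_cast h1
    have h3 := mul_le_mul_of_nonneg_left (Nat.le_ceil (δ ^ 5 / 2 ^ 14 * n * n))
      (Nat.cast_nonneg (α := ℝ) #(A + B))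
    refine le_of_mul_le_mul_right (a := (n : ℝ) ^ 2) ?_ (by positivity)
    linarith
  -- `δ ^ 5 / 2 ^ 14` from the paths times `δ ^ 2 / 32` from the sizes of `A` and `B`.
  set R : ℝ := 2 ^ 19 / δ ^ 7 with hR
  have hsum' : (#(A + B) : ℝ) ≤ R * (δ ^ 2 / 32 * n) := by
    have e : R * (δ ^ 2 / 32 * n) = n / (δ ^ 5 / 2 ^ 14) := by
      rw [hR]; field_simp; norm_num
    rw [e]
    exact (le_div_iff₀ (by positivity)).2 hsum
  obtain ⟨hR1, hT⟩ := card_nsmul_union_sub_nsmul_union_le hA hB (R := R)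
    (hsum'.trans (by gcongr)) (hsum'.trans (by gcongr))
  set T := A ∪ B with hTdef
  set W' := E.image fun p => p.1 - p.2 with hW'
  have hW'sub : W' ⊆ W := by
    intro w hw
    obtain ⟨p, hp, rfl⟩ := mem_image.1 hw
    exact (mem_filter.1 hp).2.2
  -- A given difference arises from at most `#A ≤ n` edges, since `p.1` determines the edge.
  have hW'card : δ ^ 2 / 32 * n ≤ #W' := by
    have h1 : #E ≤ n * #W' := by
      refine card_le_mul_card_image E n fun w _ => le_trans ?_ hAn
      refine card_le_card_of_injOn Prod.fst ?_ ?_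
      · intro p hp
        rw [mem_coe, mem_filter, hEdef, mem_filter, mem_product] at hp
        exact hp.1.1.1
      · intro p hp p' hp' he
        rw [mem_coe, mem_filter] at hp hp'
        have := hp.2.trans hp'.2.symm
        rw [he] at this
        exact Prod.ext he (sub_right_injective this)
    have h2 : (#E : ℝ) ≤ n * #W' := by exact_mod_cast h1
    refine le_of_mul_le_mul_right (a := (n : ℝ)) ?_ hn0
    linarith
  have hroth := (hW.mono (coe_subset.2 hW'sub)).card_le_four_mul_rothNumberNat
    (D := 4 • T - 4 • T) (by
      intro a ha b hb c hc
      obtain ⟨p, hp, rfl⟩ := mem_image.1 ha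
      obtain ⟨q, hq, rfl⟩ := mem_image.1 hb
      obtain ⟨s, hs, rfl⟩ := mem_image.1 hc
      have hmem : ∀ p ∈ E, p.1 ∈ T ∧ p.2 ∈ T := fun p hp => by
        have := mem_product.1 (mem_filter.1 hp).1
        exact ⟨mem_union_left _ this.1, mem_union_right _ this.2⟩
      have h4 : ∀ w ∈ T, ∀ x ∈ T, ∀ y ∈ T, ∀ z ∈ T, w + x + y + z ∈ 4 • T := by
        intro w hw x hx y hy z hz
        have : 4 • T = T + T + T + T := by abel
        rw [this]
        exact add_mem_add (add_mem_add (add_mem_add hw hx) hy) hz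
      -- Four terms of each sign, drawn from both `A` and `B`: hence `4 • T - 4 • T` with `T = A ∪
      -- B`.
      have e : p.1 - p.2 + (s.1 - s.2) - (q.1 - q.2 + (q.1 - q.2))
          = (p.1 + s.1 + q.2 + q.2) - (p.2 + s.2 + q.1 + q.1) := by abel
      rw [e]
      exact sub_mem_sub
        (h4 _ (hmem p hp).1 _ (hmem s hs).1 _ (hmem q hq).2 _ (hmem q hq).2)
        (h4 _ (hmem p hp).2 _ (hmem s hs).2 _ (hmem q hq).1 _ (hmem q hq).1))
  set ρ : ℝ := 256 * R ^ 24 with hρ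
  have hρ1 : 1 ≤ ρ := by
    have : 1 ≤ R ^ 24 := one_le_pow₀ hR1
    linarith
  have hDk : #(4 • T - 4 • T) ≤ ⌈ρ⌉₊ * n := by
    have : (#(4 • T - 4 • T) : ℝ) ≤ ⌈ρ⌉₊ * n := by
      refine hT.trans ?_
      gcongr
      exact Nat.le_ceil _
    exact_mod_cast this
  have h1 : #W' ≤ 4 * (⌈ρ⌉₊ * rothNumberNat n) :=
    hroth.trans (Nat.mul_le_mul_left _
      ((rothNumberNat.mono hDk).trans (rothNumberNat_mul_le _ _)))
  have h2 : (#W' : ℝ) ≤ 4 * (⌈ρ⌉₊ * rothNumberNat n) := by exact_mod_cast h1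
  have h3 : (⌈ρ⌉₊ : ℝ) ≤ 2 * ρ := by
    have := Nat.ceil_lt_add_one (by linarith : 0 ≤ ρ)
    linarith
  have h5 : δ ^ 2 / 32 * n ≤ 4 * (2 * ρ * rothNumberNat n) :=
    hW'card.trans (h2.trans (by gcongr))
  have e1 : R ^ 24 * δ ^ 168 = 2 ^ 456 := by
    rw [hR, div_pow, ← pow_mul, ← pow_mul]
    exact div_mul_cancel₀ _ (by positivity)
  calc δ ^ 170 * n = 32 * δ ^ 168 * (δ ^ 2 / 32 * n) := by ring
    _ ≤ 32 * δ ^ 168 * (4 * (2 * ρ * rothNumberNat n)) := by gcongr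
    _ = 2 ^ 16 * (R ^ 24 * δ ^ 168) * rothNumberNat n := by rw [hρ]; ring
    _ = 2 ^ 472 * rothNumberNat n := by rw [e1, ← pow_add]

theorem p3_pow_le (n : ℕ) (hn : 0 < n) :
    0 ≤ p3.{u} n ∧ p3.{u} n ^ 170 ≤ 2 ^ 472 * ((r3 n : ℝ) / n) := by
  classical
  have hn0 : (0 : ℝ) < n := by exact_mod_cast hn
  obtain ⟨G, _, _, X, Y, Z, W, hX, hY, hZ, hW, hp⟩ := (isGreatest_p3.{u} n).1
  have hp0 : 0 ≤ p3.{u} n := by rw [hp, sumDiffProb]; positivity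
  refine ⟨hp0, ?_⟩
  rcases hp0.eq_or_lt with h0 | h0
  · rw [← h0, zero_pow (by norm_num)]
    positivity
  · rw [r3_eq_rothNumberNat, ← mul_div_assoc, le_div_iff₀ hn0]
    refine pow_mul_le_mul_rothNumberNat hn hX hY hZ hW h0 (le_of_eq ?_)
    rw [hp, sumDiffProb, card_product, hX, hY, Nat.cast_mul, mul_assoc,
      div_mul_cancel₀ _ (by positivity)]

theorem Real.le_rpow_inv_mul_rpow_inv {p x C : ℝ} {k : ℕ} (hk : k ≠ 0) (hp : 0 ≤ p) (hx : 0 ≤ x)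
    (hC : 0 ≤ C) (h : p ^ k ≤ C * x) : p ≤ C ^ (k : ℝ)⁻¹ * x ^ (k : ℝ)⁻¹ := by
  rw [← Real.mul_rpow hC hx, ← Real.pow_rpow_inv_natCast hp hk]
  exact Real.rpow_le_rpow (by positivity) h (by positivity)

theorem mainTheorem4 :
    ∃ c : ℝ, 0 < c ∧ ∃ C : ℝ, 0 < C ∧ ∀ᶠ n : ℕ in Filter.atTop,
      p3.{u} n ≤ C * ((r3 n : ℝ) / (n : ℝ)) ^ c := by
  refine ⟨((170 : ℕ) : ℝ)⁻¹, by positivity, (2 ^ 472) ^ ((170 : ℕ) : ℝ)⁻¹, by positivity, ?_⟩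
  filter_upwards [Filter.eventually_gt_atTop 0] with n hn
  obtain ⟨h0, h⟩ := p3_pow_le.{u} n hn
  exact Real.le_rpow_inv_mul_rpow_inv (by norm_num) h0 (by positivity) (by positivity) h
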